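/- Let $n\ge 2$ be an integer. Write $[a,b]=a^{-1}b^{-1}ab$. Let $X_0=\{x_1,\dots,x_n\}$, $Y_0=\{y_1,\dots,y_n\}$, and let $\mathcal{H}(n)=\langle X_0\cup Y_0\mid \mathcal{R}\rangle$, where $\mathcal{R}$ consists of the following relations, for all $x,x'\in X_0$, $y,y'\in Y_0$ and $z,z',z'',z'''\in X_0\cup Y_0$: \[ z^2=1,\quad [x,x']=[y,y']=1,\quad [x,y]^2=1,\quad [[y,x],y']=1,\quad [[x,y],z]^2=1,\quad [[[z,z'],z''],z''']=1. \] Put $X=\langle X_0\rangle$ and $Y=\langle Y_0\rangle$ in $\mathcal{H}(n)$, let $\mathcal{H}(n)'$ be the derived subgroup, and let $\mathcal{H}(n)_3=[\mathcal{H}(n)',\mathcal{H}(n)]$ be the third term of the lower central series $\mathcal{H}(n)_1=\mathcal{H}(n)$, $\mathcal{H}(n)_2=\mathcal{H}(n)'$, $\dots$. A finite group $H$ with subgroups $A,B$ is called an $n$-dimensional mixed dihedral group relative to $A$ and $B$ if $A\cong B\cong C_2^n$, $H=\langle A,B\rangle$ and $H/H'\cong C_2^{2n}$. Then the following hold. (1)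 For all $x,x'\in X_0$ and $y\in Y_0$, $[[x,y],x']=[[x',y],x]$. (2) $\mathcal{H}(n)/\mathcal{H}(n)'\cong C_2^{2n}$, and $\mathcal{H}(n)$ is an $n$-dimensional mixed dihedral group relative to $X$ and $Y$ (in particular it is finite). (3) $\mathcal{H}(n)'=W\times\mathcal{H}(n)_3\cong C_2^{n^2(n+1)/2}$ (internal direct product), where (a) $W=\langle [x_i,y_j] : 1\le i,j\le n\rangle\cong C_2^{n^2}$, and (b) $\mathcal{H}(n)_3=\langle [[x_i,y_j],x_k] : 1\le i,j\le n,\ i<k\le n\rangle\cong C_2^{n^2(n-1)/2}$; moreover $\mathcal{H}(n)_3\le Z(\mathcal{H}(n))$. (4) For all $a\in\mathcal{H}(n)$ and $b,b'\in Y$, $[[b,a],b']=1$ and $[[a,b],b']=1$. (5) For every $(\alpha,\beta)\in\mathrm{Aut}(X)\times\mathrm{Aut}(Y)$ there is a unique automorphism of $\mathcal{H}(n)$ whose restrictions to $X$ and $Y$ are $\alpha$ and $\beta$. (6) Every $c\in X$ can be written as $c=x_{i_1}\cdots x_{i_k}$ and every $d\in Y$ as $d=y_{j_1}\cdots y_{j_\ell}$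 with $k,\ell\ge 0$, and for all such expressions (in particular for those with $k$ and $\ell$ minimal) \[ [c,d]\,\mathcal{H}(n)_3=\Big(\prod_{u=1}^{k}\prod_{v=1}^{\ell}[x_{i_u},y_{j_v}]\Big)\mathcal{H}(n)_3 . \] -/

import Mathlib

namespace MixedDihedral

/-- The commutator `[a, b] = a⁻¹ b⁻¹ a b` (Mathlib's `⁅a, b⁆` is `a b a⁻¹ b⁻¹`). -/
def comm {G : Type*} [Group G] (a b : G) : G := a⁻¹ * b⁻¹ * a * b

/-- The elementary abelian `2`-group `C₂ ^ m`. -/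
abbrev C2pow (m : ℕ) : Type := Fin m → Multiplicative (ZMod 2)

/-- `H` is an `n`-dimensional mixed dihedral group relative to its subgroups `X` and `Y`. -/
structure IsMixedDihedral (n : ℕ) {H : Type*} [Group H] (X Y : Subgroup H) : Prop where
  two_le : 2 ≤ n
  finite : Finite H
  iso_X : Nonempty (X ≃* C2pow n)
  iso_Y : Nonempty (Y ≃* C2pow n)
  sup_eq_top : X ⊔ Y = ⊤
  iso_quotient : Nonempty (H ⧸ commutator H ≃* C2pow (2 * n))

/-- The subgroup `K` is the internal direct product of the subgroups `A` and `B`. -/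
structure IsInternalDirectProduct {G : Type*} [Group G] (K A B : Subgroup G) : Prop where
  commute : ∀ a ∈ A, ∀ b ∈ B, Commute a b
  inf_eq_bot : A ⊓ B = ⊥
  sup_eq : A ⊔ B = K

/-- The free generator `x_i`. -/
def fx {n : ℕ} (i : Fin n) : FreeGroup (Fin n ⊕ Fin n) := FreeGroup.of (Sum.inl i)

/-- The free generator `y_j`. -/
def fy {n : ℕ} (j : Fin n) : FreeGroup (Fin n ⊕ Fin n) := FreeGroup.of (Sum.inr j)

/-- The relators of `𝓗(n)`. The variables `s t u v` run through the indices of all the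
generators `x_1, …, x_n, y_1, …, y_n`. -/
inductive Relator (n : ℕ) : FreeGroup (Fin n ⊕ Fin n) → Prop
  | sq (s : Fin n ⊕ Fin n) : Relator n (FreeGroup.of s ^ 2)
  | comm_xx (i i' : Fin n) : Relator n (comm (fx i) (fx i'))
  | comm_yy (j j' : Fin n) : Relator n (comm (fy j) (fy j'))
  | comm_xy_sq (i j : Fin n) : Relator n (comm (fx i) (fy j) ^ 2)
  | comm_yxy (j i j' : Fin n) : Relator n (comm (comm (fy j) (fx i)) (fy j'))
  | comm_xyz_sq (i j : Fin n) (s : Fin n ⊕ Fin n) :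
      Relator n (comm (comm (fx i) (fy j)) (FreeGroup.of s) ^ 2)
  | comm_four (s t u v : Fin n ⊕ Fin n) :
      Relator n (comm (comm (comm (FreeGroup.of s) (FreeGroup.of t)) (FreeGroup.of u))
        (FreeGroup.of v))

/-- The group `𝓗(n)`, given by generators and relations. -/
abbrev HGroup (n : ℕ) : Type := PresentedGroup {w | Relator n w}

/-- The generator `x_i` of `𝓗(n)`. -/
def gx {n : ℕ} (i : Fin n) : HGroup n := PresentedGroup.of (Sum.inl i)

/-- The generator `y_j` of `𝓗(n)`. -/
def gy {n : ℕ} (j : Fin n) : HGroup n := PresentedGroup.of (Sum.inr j)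

/-- `X = ⟨x_1, …, x_n⟩`. -/
def X (n : ℕ) : Subgroup (HGroup n) := Subgroup.closure (Set.range gx)

/-- `Y = ⟨y_1, …, y_n⟩`. -/
def Y (n : ℕ) : Subgroup (HGroup n) := Subgroup.closure (Set.range gy)

/-- `W = ⟨[x_i, y_j] : 1 ≤ i, j ≤ n⟩`. -/
def W (n : ℕ) : Subgroup (HGroup n) :=
  Subgroup.closure {w | ∃ i j : Fin n, w = comm (gx i) (gy j)}

/-- `𝓗(n)₃`, the third term of the lower central series
`𝓗(n)₁ = 𝓗(n)`, `𝓗(n)₂ = 𝓗(n)'`, `𝓗(n)₃ = [𝓗(n)₂, 𝓗(n)]`, …; Mathlib counts from `0`. -/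
abbrev H3 (n : ℕ) : Subgroup (HGroup n) := (⊤ : Subgroup (HGroup n)).lowerCentralSeries 2

end MixedDihedral

/-! The relations bound the group from above; representations over `ZMod 2` bound it from below.

Above: weight-four commutators of generators vanish, so `H3` is central and generated by the
weight-three ones (`lowerCentralSeries_of_closure`). The three subgroups lemma then makes the
derived subgroup abelian, and its generators are involutions. Expanding [xx', y] = [x'x, y] gives
[[x, y], x'] = [[x', y], x], while [[x, y], x] = [x, y]⁻² = 1. Hence the [x_i, y_j] and the [[x_i,
y_j], x_k] with i < k generate the derived subgroup.

Below: let x_i act on F₂[s, t]/(s², t²) as multiplication by (1 + p_i s)(1 + q_i t), and send y_j to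
the scalar a_j of this module. Then [x_i, y_j] has s-coefficient a_j p_i, and [[x_i, y_j], x_k]
becomes a_j (p_i q_k + q_i p_k) st. For p, q, a suitable unit vectors or zero, these coefficients
are dual to the generators above (`commutatorCoord_basis`), so `exists_mulEquiv_pi` shows that the
generators form a basis. The abelianization is treated in the same way with `genCoord`.

Consequently `Y` centralizes the derived subgroup, which has exponent dividing two. Arbitrary
elements of `X` and `Y` therefore satisfy the defining relations, and pairs of automorphisms extend.
The product formula is bimultiplicativity of the commutator in the class-two quotient by `H3`. -/

namespace MixedDihedral

/-! ### Commutator calculus and elementary abelian 2-groups -/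

section General

open scoped commutatorElement

variable {G G' : Type*} [Group G] [Group G']

theorem comm_eq_commutatorElement (a b : G) : comm a b = ⁅a⁻¹, b⁻¹⁆ := by
  simp [comm, commutatorElement_def]

theorem comm_eq_one_iff {a b : G} : comm a b = 1 ↔ Commute a b := by
  rw [comm_eq_commutatorElement, commutatorElement_eq_one_iff_commute,
    Commute.inv_left_iff, Commute.inv_right_iff]

theorem map_comm (f : G →* G') (a b : G) : f (comm a b) = comm (f a) (f b) := by
  simp [comm]

theorem comm_inv (a b : G) : (comm a b)⁻¹ = comm b a := by
  simp [comm, mul_assoc]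

theorem comm_mem_commutator (a b : G) : comm a b ∈ commutator G := by
  rw [comm_eq_commutatorElement]
  exact Subgroup.commutator_mem_commutator trivial trivial

theorem comm_mem_of_mem {K L : Subgroup G} {a b : G} (ha : a ∈ K) (hb : b ∈ L) :
    comm a b ∈ ⁅K, L⁆ := by
  rw [comm_eq_commutatorElement]
  exact Subgroup.commutator_mem_commutator (inv_mem ha) (inv_mem hb)

theorem comm_mem_iff_commute_mk (N : Subgroup G) [N.Normal] (a b : G) :
    comm a b ∈ N ↔ Commute (a : G ⧸ N) (b : G ⧸ N) := by
  rw [← comm_eq_one_iff, ← QuotientGroup.eq_one_iff]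
  rfl

/-- Modulo the normal subgroup `N` the claim is about commuting elements. Centralizers are
subgroups, so generators suffice, first on the side of `S` and then on that of `T`. -/
theorem commutator_closure_le {S T : Set G} (N : Subgroup G) [N.Normal]
    (h : ∀ t ∈ T, ∀ s ∈ S, comm t s ∈ N) :
    ⁅Subgroup.closure T, Subgroup.closure S⁆ ≤ N := by
  have h1 : ∀ t ∈ T, ∀ g ∈ Subgroup.closure S, Commute (t : G ⧸ N) (g : G ⧸ N) := by
    intro t ht g hg
    have : Subgroup.closure S ≤
        (Subgroup.centralizer {(t : G ⧸ N)}).comap (QuotientGroup.mk' N) := by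
      rw [Subgroup.closure_le]
      intro s hs
      simp only [Subgroup.coe_comap, Set.mem_preimage, SetLike.mem_coe,
        Subgroup.mem_centralizer_singleton_iff]
      exact (((comm_mem_iff_commute_mk N t s).1 (h t ht s hs)).symm).eq
    have := this hg
    simp only [Subgroup.mem_comap, Subgroup.mem_centralizer_singleton_iff] at this
    exact Commute.symm this
  rw [Subgroup.commutator_le]
  intro a ha g hg
  have : Subgroup.closure T ≤
      (Subgroup.centralizer {(g : G ⧸ N)}).comap (QuotientGroup.mk' N) := by
    rw [Subgroup.closure_le]
    intro s hs
    simp only [Subgroup.coe_comap, Set.mem_preimage, SetLike.mem_coe,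
      Subgroup.mem_centralizer_singleton_iff]
    exact (h1 s hs g hg).eq
  have := this ha
  simp only [Subgroup.mem_comap, Subgroup.mem_centralizer_singleton_iff] at this
  rw [← QuotientGroup.eq_one_iff]
  exact (Commute.commutator_eq (show Commute (a : G ⧸ N) (g : G ⧸ N) from this))

/-- In a group generated by `S` in which all left-normed commutators of weight four in `S` vanish,
the third term of the lower central series is generated by the commutators of weight three
in `S`, and the derived subgroup by these and the commutators of weight two. -/
theorem lowerCentralSeries_of_closure {S : Set G} (hS : Subgroup.closure S = ⊤)
    (h4 : ∀ s ∈ S, ∀ t ∈ S, ∀ u ∈ S, ∀ v ∈ S, comm (comm (comm s t) u) v = 1) :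
    (⊤ : Subgroup G).lowerCentralSeries 2 ≤ Subgroup.center G ∧
    (⊤ : Subgroup G).lowerCentralSeries 2 =
      Subgroup.closure {w | ∃ s ∈ S, ∃ t ∈ S, ∃ u ∈ S, w = comm (comm s t) u} ∧
    commutator G = Subgroup.closure {w | ∃ s ∈ S, ∃ t ∈ S, w = comm s t} ⊔
      (⊤ : Subgroup G).lowerCentralSeries 2 := by
  set T := {w | ∃ s ∈ S, ∃ t ∈ S, w = comm s t} with hT
  set P := Subgroup.closure {w | ∃ s ∈ S, ∃ t ∈ S, ∃ u ∈ S, w = comm (comm s t) u} with hP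
  have hPc : P ≤ Subgroup.center G := by
    rw [hP, Subgroup.closure_le]
    rintro _ ⟨s, hs, t, ht, u, hu, rfl⟩
    have : Subgroup.closure S ≤ Subgroup.centralizer {comm (comm s t) u} := by
      rw [Subgroup.closure_le]
      intro v hv
      rw [SetLike.mem_coe, Subgroup.mem_centralizer_singleton_iff]
      exact ((comm_eq_one_iff.1 (h4 s hs t ht u hu v hv)).symm).eq
    rw [hS] at this
    rw [SetLike.mem_coe, Subgroup.mem_center_iff]
    intro g
    exact (Subgroup.mem_centralizer_singleton_iff.1 (this (Subgroup.mem_top g)))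
  have hPn : P.Normal := ⟨fun p hp g => by
    rw [Subgroup.mem_center_iff.1 (hPc hp) g]
    simpa using hp⟩
  have hPle : P ≤ (⊤ : Subgroup G).lowerCentralSeries 2 := by
    rw [hP, Subgroup.closure_le]
    rintro _ ⟨s, hs, t, ht, u, hu, rfl⟩
    exact comm_mem_of_mem (comm_mem_commutator s t) (Subgroup.mem_top u)
  -- With Q = ⟨T⟩P, the inclusion [Q, G] ≤ P ≤ Q makes Q normal. Then Q contains G' because it
  -- contains the commutators of generators, so [G', G] ≤ [Q, G] ≤ P.
  have hQP : ⁅Subgroup.closure T ⊔ P, (⊤ : Subgroup G)⁆ ≤ P := by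
    rw [← Subgroup.closure_eq P, ← Subgroup.closure_union, ← hS, Subgroup.closure_eq P]
    apply commutator_closure_le
    rintro t (⟨s, hs, t, ht, rfl⟩ | ht) u hu
    · exact Subgroup.subset_closure ⟨s, hs, t, ht, u, hu, rfl⟩
    · have : Commute t u := (Subgroup.mem_center_iff.1 (hPc ht) u).symm
      rw [comm_eq_one_iff.2 this]
      exact one_mem _
  have hQn : (Subgroup.closure T ⊔ P).Normal :=
    Subgroup.commutator_top_right_le_iff.1 (hQP.trans le_sup_right)
  have hcQ : commutator G ≤ Subgroup.closure T ⊔ P := by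
    rw [commutator_def, ← hS]
    apply commutator_closure_le
    intro t ht s hs
    exact Subgroup.mem_sup_left (Subgroup.subset_closure ⟨t, ht, s, hs, rfl⟩)
  have hl : (⊤ : Subgroup G).lowerCentralSeries 2 = P := by
    refine le_antisymm ?_ hPle
    change ⁅commutator G, (⊤ : Subgroup G)⁆ ≤ P
    exact (Subgroup.commutator_mono hcQ le_rfl).trans hQP
  refine ⟨hl ▸ hPc, hl, hl ▸ le_antisymm hcQ (sup_le ?_ ?_)⟩
  · rw [Subgroup.closure_le]
    rintro _ ⟨s, hs, t, ht, rfl⟩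
    exact comm_mem_commutator s t
  · exact hPle.trans ((⊤ : Subgroup G).lowerCentralSeries_antitone one_le_two)

/-- Three subgroups lemma for G, G, G': two of the rotated triple commutators are [[G', G], G] = 1,
and the third is [[G, G], G']. -/
theorem commute_of_mem_commutator
    (h3 : (⊤ : Subgroup G).lowerCentralSeries 2 ≤ Subgroup.center G) {a b : G}
    (ha : a ∈ commutator G) (hb : b ∈ commutator G) : Commute a b := by
  have h1 : ⁅⁅(⊤ : Subgroup G), commutator G⁆, (⊤ : Subgroup G)⁆ = ⊥ := by
    rw [Subgroup.commutator_comm ⊤ (commutator G)]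
    exact Subgroup.commutator_top_right_eq_bot_iff_le_center.2 h3
  have h2 : ⁅⁅commutator G, (⊤ : Subgroup G)⁆, (⊤ : Subgroup G)⁆ = ⊥ :=
    Subgroup.commutator_top_right_eq_bot_iff_le_center.2 h3
  have h := Subgroup.commutator_commutator_eq_bot_of_rotate h1 h2
  rw [← commutatorElement_eq_one_iff_commute, ← Subgroup.mem_bot, ← h]
  exact Subgroup.commutator_mem_commutator ha hb

theorem sq_eq_one_of_mem_closure {T : Set G} (hc : ∀ a ∈ T, ∀ b ∈ T, Commute a b)
    (h2 : ∀ a ∈ T, a ^ 2 = 1) {a : G} (ha : a ∈ Subgroup.closure T) : a ^ 2 = 1 := by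
  have hcc : ∀ a ∈ Subgroup.closure T, ∀ b ∈ Subgroup.closure T, Commute a b := by
    have := Subgroup.isMulCommutative_closure (k := T) (fun a ha b hb => hc a ha b hb)
    intro a ha b hb
    exact congrArg Subtype.val (this.is_comm.comm ⟨a, ha⟩ ⟨b, hb⟩)
  induction ha using Subgroup.closure_induction with
  | mem x hx => exact h2 x hx
  | one => simp
  | mul x y hx hy ihx ihy => rw [(hcc x hx y hy).mul_pow, ihx, ihy, one_mul]
  | inv x hx ih => rw [inv_pow, ih, inv_one]

theorem commute_of_mem_closure {T : Set G} (hc : ∀ a ∈ T, ∀ b ∈ T, Commute a b)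
    {a b : G} (ha : a ∈ Subgroup.closure T) (hb : b ∈ Subgroup.closure T) : Commute a b := by
  have := Subgroup.isMulCommutative_closure (k := T) (fun a ha b hb => hc a ha b hb)
  exact congrArg Subtype.val (this.is_comm.comm ⟨a, ha⟩ ⟨b, hb⟩)

/-- If `[a, b]` is an involution and so are `a`, `b`, then `[[a, b], a] = 1`. -/
theorem comm_comm_self {a b : G} (ha : a ^ 2 = 1) (hb : b ^ 2 = 1) (hab : comm a b ^ 2 = 1) :
    comm (comm a b) a = 1 := by
  have ha' : a⁻¹ = a := inv_eq_of_mul_eq_one_left (by rw [← sq, ha])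
  have hb' : b⁻¹ = b := inv_eq_of_mul_eq_one_left (by rw [← sq, hb])
  -- For involutions [a, b] = abab, and conjugation by `a` turns this into baba, its inverse.
  have h : comm (comm a b) a = (comm a b ^ 2)⁻¹ := by
    rw [sq, mul_inv_rev]
    simp only [comm, mul_inv_rev, inv_inv]
    simp only [ha', hb', mul_assoc]
    rw [sq] at ha
    rw [← mul_assoc a a, ha, one_mul]
  rw [h, hab, inv_one]

theorem comm_mul_left (a b c : G) : comm (a * b) c = b⁻¹ * comm a c * b * comm b c := by
  simp [comm, mul_assoc]

theorem comm_mul_right (a b c : G) : comm a (b * c) = comm a c * (c⁻¹ * comm a b * c) := by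
  simp [comm, mul_assoc]

theorem conj_eq_mul_comm (a b : G) : b⁻¹ * a * b = a * comm a b := by
  simp [comm, mul_assoc]

/-- Expand [aa', b] = [a'a, b] on both sides. The factors [a, b] and [a', b] commute and the
weight-three factors are central, so everything else cancels. -/
theorem comm_comm_swap (h3 : (⊤ : Subgroup G).lowerCentralSeries 2 ≤ Subgroup.center G)
    {a a' b : G} (h : Commute a a') :
    comm (comm a b) a' = comm (comm a' b) a := by
  have h1 := comm_mul_left a a' b
  have h2 := comm_mul_left a' a b
  rw [← h.eq, h1, conj_eq_mul_comm, conj_eq_mul_comm] at h2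
  have hz : ∀ c d e : G, comm (comm c d) e ∈ Subgroup.center G := fun c d e =>
    h3 (comm_mem_of_mem (comm_mem_commutator c d) (Subgroup.mem_top e))
  have hw : Commute (comm a b) (comm a' b) :=
    commute_of_mem_commutator h3 (comm_mem_commutator _ _) (comm_mem_commutator _ _)
  rw [mul_assoc, ← Subgroup.mem_center_iff.1 (hz a b a'), ← mul_assoc, hw.eq, mul_assoc (comm a' b)
    (comm (comm a' b) a), ← Subgroup.mem_center_iff.1 (hz a' b a), ← mul_assoc] at h2
  exact mul_left_cancel h2

/-- In a group of class two the commutator is multiplicative in both arguments. -/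
theorem comm_list_prod (h : ∀ a b : G, comm a b ∈ Subgroup.center G) {ι κ : Type*}
    (f : ι → G) (g : κ → G) (I : List ι) (J : List κ) :
    comm (I.map f).prod (J.map g).prod =
      (I.flatMap fun i => J.map fun j => comm (f i) (g j)).prod := by
  have hconj : ∀ a b c : G, c⁻¹ * comm a b * c = comm a b := fun a b c => by
    rw [mul_assoc, ← Subgroup.mem_center_iff.1 (h a b), inv_mul_cancel_left]
  have hr : ∀ a : G, comm a (J.map g).prod = (J.map fun j => comm a (g j)).prod := by
    intro a
    induction J with
    | nil => simp [comm]
    | cons j J ih =>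
      rw [List.map_cons, List.prod_cons, comm_mul_right, hconj, ih, List.map_cons, List.prod_cons,
        Subgroup.mem_center_iff.1 (h a (g j))]
  induction I with
  | nil => simp [comm]
  | cons i I ih =>
    rw [List.map_cons, List.prod_cons, comm_mul_left, hconj, ih, List.flatMap_cons,
      List.prod_append, hr]

/-- The homomorphism from the group of order two given by an element with square `1`. -/
def involutionHom (g : G) (hg : g ^ 2 = 1) : Multiplicative (ZMod 2) →* G where
  toFun t := g ^ (t.toAdd.val)
  map_one' := by simp
  map_mul' s t := by
    rw [toAdd_mul, ← pow_add, ZMod.val_add]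
    exact (pow_eq_pow_mod _ hg).symm

theorem involutionHom_ofAdd_one (g : G) (hg : g ^ 2 = 1) :
    involutionHom g hg (Multiplicative.ofAdd 1) = g := by
  change g ^ (1 : ZMod 2).val = g
  rw [ZMod.val_one, pow_one]

theorem hom_ext_of_ofAdd_one {f g : Multiplicative (ZMod 2) →* G}
    (h : f (Multiplicative.ofAdd 1) = g (Multiplicative.ofAdd 1)) : f = g := by
  refine MonoidHom.ext fun t => ?_
  have h2 : ∀ t : Multiplicative (ZMod 2), t = 1 ∨ t = Multiplicative.ofAdd 1 := by decide
  rcases h2 t with rfl | rfl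
  · simp
  · exact h

/-- A group generated by commuting involutions `g i` that admits a coordinate homomorphism
is elementary abelian with basis `g`. -/
theorem exists_mulEquiv_pi {ι : Type*} [Fintype ι] [DecidableEq ι] (g : ι → G)
    (htop : Subgroup.closure (Set.range g) = ⊤) (hc : ∀ i j, Commute (g i) (g j))
    (h2 : ∀ i, g i ^ 2 = 1) (δ : G →* (ι → Multiplicative (ZMod 2)))
    (hδ : ∀ i, δ (g i) = Pi.mulSingle i (Multiplicative.ofAdd 1)) :
    ∃ e : G ≃* (ι → Multiplicative (ZMod 2)), ∀ x, e x = δ x := by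
  -- Commuting involutions allow coordinates to be multiplied back into `G`. That `Φ` and `δ` are
  -- mutually inverse need only be checked on the `g i` and on the unit vectors.
  let Φ : (ι → Multiplicative (ZMod 2)) →* G :=
    MonoidHom.noncommPiCoprod (fun i => involutionHom (g i) (h2 i))
      (fun i j _ x y => (hc i j).pow_pow _ _)
  have hΦ : ∀ i, Φ (Pi.mulSingle i (Multiplicative.ofAdd 1)) = g i := fun i => by
    exact (MonoidHom.noncommPiCoprod_mulSingle (fun i => involutionHom (g i) (h2 i)) i _).trans
      (involutionHom_ofAdd_one _ _)
  have h1 : Φ.comp δ = MonoidHom.id G := by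
    apply MonoidHom.eq_of_eqOn_dense htop
    rintro _ ⟨i, rfl⟩
    simp [hδ, hΦ]
  have h2 : δ.comp Φ = MonoidHom.id _ := by
    apply MonoidHom.pi_ext
    intro i x
    have := hom_ext_of_ofAdd_one (f := (δ.comp Φ).comp (MonoidHom.mulSingle (fun _ : ι => Multiplicative (ZMod 2)) i))
      (g := MonoidHom.mulSingle (fun _ : ι => Multiplicative (ZMod 2)) i)
      (by simp [hΦ, hδ])
    exact DFunLike.congr_fun this x
  exact ⟨MonoidHom.toMulEquiv δ Φ h1 h2, fun x => rfl⟩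

theorem exists_mulEquiv_pi_subgroup {ι : Type*} [Fintype ι] [DecidableEq ι] (g : ι → G)
    {K : Subgroup G} (hK : K = Subgroup.closure (Set.range g)) (hc : ∀ i j, Commute (g i) (g j))
    (h2 : ∀ i, g i ^ 2 = 1) (δ : K →* (ι → Multiplicative (ZMod 2)))
    (hδ : ∀ i (h : g i ∈ K), δ ⟨g i, h⟩ = Pi.mulSingle i (Multiplicative.ofAdd 1)) :
    ∃ e : K ≃* (ι → Multiplicative (ZMod 2)), ∀ x, e x = δ x := by
  subst hK
  have hm : ∀ i, g i ∈ Subgroup.closure (Set.range g) := fun i =>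
    Subgroup.subset_closure ⟨i, rfl⟩
  refine exists_mulEquiv_pi (fun i => (⟨g i, hm i⟩ : Subgroup.closure (Set.range g))) ?_
    (fun i j => Subtype.ext (hc i j)) (fun i => Subtype.ext (h2 i)) δ (fun i => hδ i _)
  rw [← Subgroup.closure_closure_coe_preimage (k := Set.range g)]
  congr 1
  ext x
  simp [Subtype.ext_iff]

theorem nonempty_mulEquiv_C2pow {ι : Type*} [Fintype ι] {m : ℕ} (h : Fintype.card ι = m)
    (e : G ≃* (ι → Multiplicative (ZMod 2))) : Nonempty (G ≃* C2pow m) := by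
  obtain ⟨f⟩ : Nonempty (ι ≃ Fin m) := ⟨Fintype.equivFinOfCardEq h⟩
  exact ⟨e.trans (MulEquiv.arrowCongr f (MulEquiv.refl _))⟩

end General

/-! ### The representations that detect commutators -/

/-- The group `R[s, t]/(s², t²) ⋊ (R × R)`, where `(p, q)` acts as multiplication by
`(1 + p s) (1 + q t)`. The element with coordinates `p q a b d c` is
`(a + b s + d t + c s t, (p, q))`. -/
@[ext]
structure Affine (R : Type*) where
  p : R
  q : R
  a : R
  b : R
  d : R
  c : R

namespace Affine

section CommRing

variable {R : Type*} [CommRing R]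

instance : Mul (Affine R) where
  mul x y := ⟨x.p + y.p, x.q + y.q, x.a + y.a, x.b + y.b + y.a * x.p, x.d + y.d + y.a * x.q,
    x.c + y.c + y.b * x.q + y.d * x.p + y.a * x.p * x.q⟩

instance : One (Affine R) where
  one := ⟨0, 0, 0, 0, 0, 0⟩

instance : Inv (Affine R) where
  inv x := ⟨-x.p, -x.q, -x.a, -x.b + x.a * x.p, -x.d + x.a * x.q,
    -x.c + x.b * x.q + x.d * x.p - x.a * x.p * x.q⟩

theorem mul_def (x y : Affine R) : x * y = ⟨x.p + y.p, x.q + y.q, x.a + y.a,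
    x.b + y.b + y.a * x.p, x.d + y.d + y.a * x.q,
    x.c + y.c + y.b * x.q + y.d * x.p + y.a * x.p * x.q⟩ := rfl

theorem one_def : (1 : Affine R) = ⟨0, 0, 0, 0, 0, 0⟩ := rfl

theorem inv_def (x : Affine R) : x⁻¹ = ⟨-x.p, -x.q, -x.a, -x.b + x.a * x.p, -x.d + x.a * x.q,
    -x.c + x.b * x.q + x.d * x.p - x.a * x.p * x.q⟩ := rfl

instance : Group (Affine R) where
  mul_assoc x y z := by ext <;> simp only [mul_def] <;> ring
  one_mul x := by ext <;> simp only [mul_def, one_def] <;> ring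
  mul_one x := by ext <;> simp only [mul_def, one_def] <;> ring
  inv_mul_cancel x := by ext <;> simp only [mul_def, one_def, inv_def] <;> ring

/-- The element of the complement `R × R` with coordinates `p` and `q`. -/
def translation (p q : R) : Affine R := ⟨p, q, 0, 0, 0, 0⟩

/-- The scalar `a` as an element of the normal subgroup `R[s, t]/(s², t²)`. -/
def scalar (a : R) : Affine R := ⟨0, 0, a, 0, 0, 0⟩

/-- The ideal `(s, t)` as a normal subgroup. -/
def augmentation (R : Type*) [CommRing R] : Subgroup (Affine R) where
  carrier := {z | z.p = 0 ∧ z.q = 0 ∧ z.a = 0}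
  one_mem' := ⟨rfl, rfl, rfl⟩
  mul_mem' := by
    rintro x y ⟨h1, h2, h3⟩ ⟨h4, h5, h6⟩
    simp [mul_def, h1, h2, h3, h4, h5, h6]
  inv_mem' := by
    rintro x ⟨h1, h2, h3⟩
    simp [inv_def, h1, h2, h3]

theorem mem_augmentation {z : Affine R} : z ∈ augmentation R ↔ z.p = 0 ∧ z.q = 0 ∧ z.a = 0 :=
  Iff.rfl

/-- The coefficient of `s`. -/
def coeffS : augmentation R →* Multiplicative R where
  toFun z := Multiplicative.ofAdd z.1.b
  map_one' := rfl
  map_mul' := by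
    rintro ⟨x, h1, h2, h3⟩ ⟨y, h4, h5, h6⟩
    rw [← ofAdd_add]
    simp [mul_def, h6]

/-- The coefficient of `s t`. -/
def coeffST : augmentation R →* Multiplicative R where
  toFun z := Multiplicative.ofAdd z.1.c
  map_one' := rfl
  map_mul' := by
    rintro ⟨x, h1, h2, h3⟩ ⟨y, h4, h5, h6⟩
    rw [← ofAdd_add]
    simp [mul_def, h6, h1, h2]

/-- The coordinates `p`, `q`, `a` are homomorphisms to the abelian group `R`, so they vanish on
commutators. -/
theorem comm_mem_augmentation (x y : Affine R) : comm x y ∈ augmentation R := by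
  simp only [mem_augmentation, comm, mul_def, inv_def]
  refine ⟨?_, ?_, ?_⟩ <;> ring

/-- Multiplying the ideal (s, t) by `s` or `t` leaves only multiples of st, which are fixed by the
action. This yields both the vanishing in weight four and the commutation of commutators with
scalars. -/
theorem comm_of_mem_augmentation {z : Affine R} (h : z ∈ augmentation R) (u : Affine R) :
    comm z u = ⟨0, 0, 0, 0, 0, -(z.b * u.q + z.d * u.p)⟩ := by
  obtain ⟨h1, h2, h3⟩ := h
  ext <;> simp only [comm, mul_def, inv_def, h1, h2, h3] <;> ring

theorem comm_translation_scalar (p q a : R) :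
    comm (translation p q) (scalar a) = ⟨0, 0, 0, a * p, a * q, -(a * p * q)⟩ := by
  ext <;> simp only [comm, mul_def, inv_def, translation, scalar] <;> ring

theorem comm_translation (p q p' q' : R) :
    comm (translation p q) (translation p' q') = 1 := by
  ext <;> simp only [comm, mul_def, inv_def, translation, one_def] <;> ring

theorem comm_scalar (a a' : R) : comm (scalar a) (scalar a') = 1 := by
  ext <;> simp only [comm, mul_def, inv_def, scalar, one_def] <;> ring

theorem comm_comm_comm (x y z u : Affine R) : comm (comm (comm x y) z) u = 1 := by
  rw [comm_of_mem_augmentation (comm_mem_augmentation _ _),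
    comm_of_mem_augmentation (comm_mem_augmentation _ _)]
  simp [one_def]

theorem comm_comm_scalar (x y : Affine R) (a : R) : comm (comm x y) (scalar a) = 1 := by
  rw [comm_of_mem_augmentation (comm_mem_augmentation _ _)]
  simp [one_def, scalar]

variable [CharP R 2]

theorem translation_sq (p q : R) : translation p q ^ 2 = 1 := by
  ext <;> simp [sq, mul_def, translation, one_def, CharTwo.add_self_eq_zero]

theorem scalar_sq (a : R) : scalar a ^ 2 = 1 := by
  ext <;> simp [sq, mul_def, scalar, one_def, CharTwo.add_self_eq_zero]

theorem sq_of_mem_augmentation {z : Affine R} (h : z ∈ augmentation R) : z ^ 2 = 1 := by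
  obtain ⟨h1, h2, h3⟩ := h
  ext <;> simp [sq, mul_def, h1, h2, h3, one_def, CharTwo.add_self_eq_zero]

end CommRing

/-- The values on the generators of the representation of `𝓗(n)` in `Affine (ZMod 2)` given by
coordinate vectors `p`, `q`, `a`. -/
def repGen {n : ℕ} (p q a : Fin n → ZMod 2) : Fin n ⊕ Fin n → Affine (ZMod 2) :=
  Sum.elim (fun i => translation (p i) (q i)) (fun j => scalar (a j))

theorem lift_repGen_relator {n : ℕ} (p q a : Fin n → ZMod 2) (w : FreeGroup (Fin n ⊕ Fin n))
    (h : w ∈ {w | Relator n w}) : FreeGroup.lift (repGen p q a) w = 1 := by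
  have hx : ∀ i : Fin n, FreeGroup.lift (repGen p q a) (fx i) = translation (p i) (q i) :=
    fun i => by simp [fx, repGen]
  have hy : ∀ i : Fin n, FreeGroup.lift (repGen p q a) (fy i) = scalar (a i) :=
    fun i => by simp [fy, repGen]
  obtain s | ⟨i, i'⟩ | ⟨j, j'⟩ | ⟨i, j⟩ | ⟨j, i, j'⟩ | ⟨i, j, s⟩ | ⟨s, t, u, v⟩ := h
  · rw [map_pow, FreeGroup.lift_apply_of]
    cases s
    · exact translation_sq _ _
    · exact scalar_sq _
  · rw [map_comm, hx, hx, comm_translation]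
  · rw [map_comm, hy, hy, comm_scalar]
  · rw [map_pow, map_comm, sq_of_mem_augmentation (comm_mem_augmentation _ _)]
  · rw [map_comm, map_comm, hy j', comm_comm_scalar]
  · rw [map_pow, map_comm, sq_of_mem_augmentation (comm_mem_augmentation _ _)]
  · simp only [map_comm, comm_comm_comm]

/-- The representation of `𝓗(n)` in `Affine (ZMod 2)` given by coordinate vectors. -/
def rep {n : ℕ} (p q a : Fin n → ZMod 2) : HGroup n →* Affine (ZMod 2) :=
  PresentedGroup.toGroup (lift_repGen_relator p q a)

theorem rep_gx {n : ℕ} (p q a : Fin n → ZMod 2) (i : Fin n) :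
    rep p q a (gx i) = translation (p i) (q i) :=
  PresentedGroup.toGroup.of _

theorem rep_gy {n : ℕ} (p q a : Fin n → ZMod 2) (j : Fin n) :
    rep p q a (gy j) = scalar (a j) :=
  PresentedGroup.toGroup.of _

theorem rep_comm {n : ℕ} (p q a : Fin n → ZMod 2) (i j : Fin n) :
    rep p q a (comm (gx i) (gy j)) = ⟨0, 0, 0, a j * p i, a j * q i, -(a j * p i * q i)⟩ := by
  rw [map_comm, rep_gx, rep_gy, comm_translation_scalar]

/-- The value is symmetric in `i` and `k` and vanishes for `i = k` in characteristic two, as the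
relations force; two independent parameters `p`, `q` are needed to make it nonzero. -/
theorem rep_comm_comm {n : ℕ} (p q a : Fin n → ZMod 2) (i j k : Fin n) :
    rep p q a (comm (comm (gx i) (gy j)) (gx k)) =
      ⟨0, 0, 0, 0, 0, a j * (p i * q k + q i * p k)⟩ := by
  rw [map_comm, rep_comm, rep_gx, comm_of_mem_augmentation ⟨rfl, rfl, rfl⟩]
  ext <;> simp only [translation, CharTwo.neg_eq]
  ring

theorem rep_mem_augmentation {n : ℕ} (p q a : Fin n → ZMod 2) {g : HGroup n}
    (hg : g ∈ commutator (HGroup n)) : rep p q a g ∈ augmentation (ZMod 2) := by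
  have : commutator (HGroup n) ≤ (augmentation (ZMod 2)).comap (rep p q a) := by
    rw [commutator_eq_closure, Subgroup.closure_le]
    rintro _ ⟨x, y, rfl⟩
    have h := comm_mem_augmentation (rep p q a x⁻¹) (rep p q a y⁻¹)
    rw [← map_comm] at h
    simpa [comm, commutatorElement_def] using h
  exact this hg

/-- The representation restricted to the derived subgroup. -/
def repCommutator {n : ℕ} (p q a : Fin n → ZMod 2) :
    commutator (HGroup n) →* augmentation (ZMod 2) :=
  ((rep p q a).comp (commutator (HGroup n)).subtype).codRestrict (augmentation (ZMod 2))
    fun g => rep_mem_augmentation p q a g.2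

end Affine
-- Generators of the derived subgroup and of `H3`
section Structure

variable {n : ℕ}

/-- The image of a generator of the free group in `𝓗(n)`. -/
def gen (s : Fin n ⊕ Fin n) : HGroup n := PresentedGroup.of s

theorem mk_relator {w : FreeGroup (Fin n ⊕ Fin n)} (h : Relator n w) :
    PresentedGroup.mk {w | Relator n w} w = 1 :=
  PresentedGroup.one_of_mem h

theorem gen_sq (s : Fin n ⊕ Fin n) : gen s ^ 2 = 1 := mk_relator (.sq s)

theorem gx_sq (i : Fin n) : gx i ^ 2 = 1 := gen_sq _

theorem gy_sq (j : Fin n) : gy j ^ 2 = 1 := gen_sq _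

theorem commute_gx (i i' : Fin n) : Commute (gx i) (gx i') := by
  have h := mk_relator (.comm_xx i i')
  rw [map_comm] at h
  exact comm_eq_one_iff.1 h

theorem commute_gy (j j' : Fin n) : Commute (gy j) (gy j') := by
  have h := mk_relator (.comm_yy j j')
  rw [map_comm] at h
  exact comm_eq_one_iff.1 h

theorem comm_gx_gy_sq (i j : Fin n) : comm (gx i) (gy j) ^ 2 = 1 := by
  have h := mk_relator (.comm_xy_sq i j)
  rwa [map_pow, map_comm] at h

theorem comm_gy_gx (i j : Fin n) : comm (gy j) (gx i) = comm (gx i) (gy j) := by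
  rw [← comm_inv, inv_eq_iff_mul_eq_one, ← sq, comm_gx_gy_sq]

theorem comm_comm_gy (i j j' : Fin n) : comm (comm (gx i) (gy j)) (gy j') = 1 := by
  have h := mk_relator (.comm_yxy j i j')
  rw [map_comm, map_comm] at h
  rw [← comm_gy_gx]
  exact h

theorem comm_comm_gx_sq (i j k : Fin n) : comm (comm (gx i) (gy j)) (gx k) ^ 2 = 1 := by
  have h := mk_relator (.comm_xyz_sq i j (Sum.inl k))
  rw [map_pow, map_comm, map_comm] at h
  exact h

theorem closure_range_gen : Subgroup.closure (Set.range (gen (n := n))) = ⊤ :=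
  PresentedGroup.closure_range_of _

theorem lowerCentralSeries_hGroup :
    H3 n ≤ Subgroup.center (HGroup n) ∧
    H3 n = Subgroup.closure {w | ∃ s ∈ Set.range (gen (n := n)), ∃ t ∈ Set.range (gen (n := n)),
      ∃ u ∈ Set.range (gen (n := n)), w = comm (comm s t) u} ∧
    commutator (HGroup n) = Subgroup.closure {w | ∃ s ∈ Set.range (gen (n := n)),
      ∃ t ∈ Set.range (gen (n := n)), w = comm s t} ⊔ H3 n := by
  apply lowerCentralSeries_of_closure closure_range_gen
  rintro _ ⟨s, rfl⟩ _ ⟨t, rfl⟩ _ ⟨u, rfl⟩ _ ⟨v, rfl⟩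
  have h := mk_relator (.comm_four s t u v)
  rw [map_comm, map_comm, map_comm] at h
  exact h

theorem H3_le_center : H3 n ≤ Subgroup.center (HGroup n) := lowerCentralSeries_hGroup.1

theorem comm_comm_mem_H3 (a b c : HGroup n) : comm (comm a b) c ∈ H3 n :=
  comm_mem_of_mem (comm_mem_commutator a b) (Subgroup.mem_top c)

theorem H3_le_commutator : H3 n ≤ commutator (HGroup n) :=
  (⊤ : Subgroup (HGroup n)).lowerCentralSeries_antitone one_le_two

theorem comm_comm_gx_swap (i i' j : Fin n) :
    comm (comm (gx i) (gy j)) (gx i') = comm (comm (gx i') (gy j)) (gx i) :=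
  comm_comm_swap H3_le_center (commute_gx i i')

theorem comm_comm_gx_self (i j : Fin n) : comm (comm (gx i) (gy j)) (gx i) = 1 :=
  comm_comm_self (gx_sq i) (gy_sq j) (comm_gx_gy_sq i j)

/-- Among weight-three commutators of generators, those starting with two x's or two y's are
trivial, as are those ending in a y. Since [y, x] = [x, y], only [[x_i, y_j], x_k] remains; it is
symmetric in `i`, `k` and trivial for `i = k`. -/
theorem H3_eq_closure : H3 n = Subgroup.closure {w | ∃ i j k : Fin n, i < k ∧
    w = comm (comm (gx i) (gy j)) (gx k)} := by
  apply le_antisymm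
  · rw [lowerCentralSeries_hGroup.2.1, Subgroup.closure_le]
    have hxx : ∀ i j k : Fin n, comm (comm (gx i) (gy j)) (gx k) ∈
        Subgroup.closure {w | ∃ i j k : Fin n, i < k ∧
          w = comm (comm (gx i) (gy j)) (gx k)} := by
      intro i j k
      rcases lt_trichotomy i k with h | rfl | h
      · exact Subgroup.subset_closure ⟨i, j, k, h, rfl⟩
      · rw [comm_comm_gx_self]
        exact one_mem _
      · rw [comm_comm_gx_swap]
        exact Subgroup.subset_closure ⟨k, j, i, h, rfl⟩
    have hxy : ∀ (i j : Fin n) (u : Fin n ⊕ Fin n), comm (comm (gx i) (gy j)) (gen u) ∈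
        Subgroup.closure {w | ∃ i j k : Fin n, i < k ∧
          w = comm (comm (gx i) (gy j)) (gx k)} := by
      rintro i j (k | k)
      · exact hxx i j k
      · change comm (comm (gx i) (gy j)) (gy k) ∈ _
        rw [comm_comm_gy]
        exact one_mem _
    have hone : ∀ u : HGroup n, comm 1 u = 1 := fun u => by simp [comm]
    rintro _ ⟨_, ⟨s, rfl⟩, _, ⟨t, rfl⟩, _, ⟨u, rfl⟩, rfl⟩
    rcases s with i | j <;> rcases t with i' | j'
    · change comm (comm (gx i) (gx i')) _ ∈ _
      rw [comm_eq_one_iff.2 (commute_gx i i'), hone]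
      exact one_mem _
    · exact hxy i j' u
    · change comm (comm (gy j) (gx i')) _ ∈ _
      rw [comm_gy_gx]
      exact hxy i' j u
    · change comm (comm (gy j) (gy j')) _ ∈ _
      rw [comm_eq_one_iff.2 (commute_gy j j'), hone]
      exact one_mem _
  · rw [Subgroup.closure_le]
    rintro _ ⟨i, j, k, -, rfl⟩
    exact comm_comm_mem_H3 _ _ _

theorem W_le_commutator : W n ≤ commutator (HGroup n) := by
  rw [W, Subgroup.closure_le]
  rintro _ ⟨i, j, rfl⟩
  exact comm_mem_commutator _ _

theorem W_sup_H3 : W n ⊔ H3 n = commutator (HGroup n) := by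
  apply le_antisymm (sup_le W_le_commutator H3_le_commutator)
  rw [lowerCentralSeries_hGroup.2.2]
  refine sup_le_sup_right ?_ _
  rw [Subgroup.closure_le]
  have hxy : ∀ i j : Fin n, comm (gx i) (gy j) ∈ W n := fun i j =>
    Subgroup.subset_closure ⟨i, j, rfl⟩
  rintro _ ⟨_, ⟨s, rfl⟩, _, ⟨t, rfl⟩, rfl⟩
  rcases s with i | j <;> rcases t with i' | j'
  · change comm (gx i) (gx i') ∈ _
    rw [comm_eq_one_iff.2 (commute_gx i i')]
    exact one_mem _
  · exact hxy i j'
  · change comm (gy j) (gx i') ∈ _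
    rw [comm_gy_gx]
    exact hxy i' j
  · change comm (gy j) (gy j') ∈ _
    rw [comm_eq_one_iff.2 (commute_gy j j')]
    exact one_mem _

theorem commute_of_mem_commutator_hGroup {a b : HGroup n} (ha : a ∈ commutator (HGroup n))
    (hb : b ∈ commutator (HGroup n)) : Commute a b :=
  commute_of_mem_commutator H3_le_center ha hb

/-! ### Coordinates on the derived subgroup -/

/-- Indices for the basis of `𝓗(n)₃`. -/
abbrev TripleIndex (n : ℕ) : Type := {t : Fin n × Fin n // t.1 < t.2} × Fin n

/-- The basis of `𝓗(n)'`: the commutators `[x_i, y_j]`, and `[[x_i, y_j], x_k]` with `i < k`. -/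
def commutatorBasis : (Fin n × Fin n) ⊕ TripleIndex n → HGroup n :=
  Sum.elim (fun t => comm (gx t.1) (gy t.2))
    (fun t => comm (comm (gx t.1.1.1) (gy t.2)) (gx t.1.1.2))

theorem W_eq_closure_range :
    W n = Subgroup.closure (Set.range fun t => commutatorBasis (n := n) (Sum.inl t)) := by
  rw [W]
  congr 1
  ext w
  simp [commutatorBasis, eq_comm]

theorem H3_eq_closure_range :
    H3 n = Subgroup.closure (Set.range fun t => commutatorBasis (n := n) (Sum.inr t)) := by
  rw [H3_eq_closure]
  congr 1
  ext w
  constructor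
  · rintro ⟨i, j, k, h, rfl⟩
    exact ⟨(⟨(i, k), h⟩, j), rfl⟩
  · rintro ⟨⟨⟨⟨i, k⟩, h⟩, j⟩, rfl⟩
    exact ⟨i, j, k, h, rfl⟩

theorem commutator_eq_closure_range :
    commutator (HGroup n) = Subgroup.closure (Set.range (commutatorBasis (n := n))) := by
  rw [← W_sup_H3, W_eq_closure_range, H3_eq_closure_range, ← Subgroup.closure_union]
  congr 1
  ext w
  simp only [Set.mem_union, Set.mem_range, Sum.exists]

theorem commutatorBasis_mem (t : (Fin n × Fin n) ⊕ TripleIndex n) :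
    commutatorBasis t ∈ commutator (HGroup n) := by
  rw [commutator_eq_closure_range]
  exact Subgroup.subset_closure ⟨t, rfl⟩

theorem commutatorBasis_sq (t : (Fin n × Fin n) ⊕ TripleIndex n) : commutatorBasis t ^ 2 = 1 := by
  rcases t with t | t
  · exact comm_gx_gy_sq _ _
  · exact comm_comm_gx_sq _ _ _

theorem sq_of_mem_commutator {g : HGroup n} (hg : g ∈ commutator (HGroup n)) : g ^ 2 = 1 := by
  rw [commutator_eq_closure_range] at hg
  refine sq_eq_one_of_mem_closure ?_ ?_ hg
  · rintro _ ⟨s, rfl⟩ _ ⟨t, rfl⟩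
    exact commute_of_mem_commutator_hGroup (commutatorBasis_mem s) (commutatorBasis_mem t)
  · rintro _ ⟨s, rfl⟩
    exact commutatorBasis_sq s

/-- The coordinates of elements of `𝓗(n)'` with respect to `commutatorBasis`. -/
def commutatorCoord :
    commutator (HGroup n) →* ((Fin n × Fin n) ⊕ TripleIndex n → Multiplicative (ZMod 2)) :=
  MonoidHom.pi <| Sum.rec
    (fun t => Affine.coeffS.comp
      (Affine.repCommutator (Pi.single t.1 1) 0 (Pi.single t.2 1)))
    (fun t => Affine.coeffST.comp
      (Affine.repCommutator (Pi.single t.1.1.1 1) (Pi.single t.1.1.2 1) (Pi.single t.2 1)))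

/-- Pair coordinates read the s-coefficient, which is zero on weight-three commutators. Triple
coordinates read the st-coefficient, with `p` and `q` unit vectors at distinct indices, so that the
term p_i q_i of [x_i, y_j] vanishes. -/
theorem commutatorCoord_basis (t : (Fin n × Fin n) ⊕ TripleIndex n)
    (h : commutatorBasis t ∈ commutator (HGroup n)) :
    commutatorCoord ⟨commutatorBasis t, h⟩ = Pi.mulSingle t (Multiplicative.ofAdd 1) := by
  funext u
  rcases t with ⟨i, j⟩ | ⟨⟨⟨i, k⟩, hik⟩, j⟩ <;> rcases u with ⟨i', j'⟩ | ⟨⟨⟨i', k'⟩, hik'⟩, j'⟩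
  · change Multiplicative.ofAdd (Affine.rep (Pi.single i' 1) 0 (Pi.single j' 1)
      (comm (gx i) (gy j))).b = _
    rw [Affine.rep_comm]
    by_cases h1 : i = i' <;> by_cases h2 : j = j' <;>
      simp [h1, h2, eq_comm]
  · change Multiplicative.ofAdd (Affine.rep (Pi.single i' 1) (Pi.single k' 1) (Pi.single j' 1)
      (comm (gx i) (gy j))).c = _
    rw [Affine.rep_comm]
    have hne : i' ≠ k' := ne_of_lt hik'
    by_cases h1 : i = i'
    · subst h1
      simp [hne]
    · simp [h1]
  · change Multiplicative.ofAdd (Affine.rep (Pi.single i' 1) 0 (Pi.single j' 1)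
      (comm (comm (gx i) (gy j)) (gx k))).b = _
    rw [Affine.rep_comm_comm]
    simp
  · change Multiplicative.ofAdd (Affine.rep (Pi.single i' 1) (Pi.single k' 1) (Pi.single j' 1)
      (comm (comm (gx i) (gy j)) (gx k))).c = _
    rw [Affine.rep_comm_comm]
    -- The cross term q_i p_k would need `i = k'` and `k = i'`, against `i < k` and `i' < k'`.
    have h0 : (Pi.single k' 1 : Fin n → ZMod 2) i * (Pi.single i' 1 : Fin n → ZMod 2) k = 0 := by
      by_cases h : i = k'
      · have : k ≠ i' := fun h' => lt_asymm hik (h ▸ h' ▸ hik')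
        rw [Pi.single_eq_of_ne this, mul_zero]
      · rw [Pi.single_eq_of_ne h, zero_mul]
    rw [h0, add_zero]
    by_cases h1 : i = i'
    · by_cases h2 : j = j'
      · by_cases h3 : k = k'
        · subst h1 h2 h3
          simp
        · simp [h3, Ne.symm h3]
      · simp [h2, Ne.symm h2]
    · simp [h1, Ne.symm h1]

theorem exists_commutatorCoord_equiv : ∃ e : commutator (HGroup n) ≃*
    ((Fin n × Fin n) ⊕ TripleIndex n → Multiplicative (ZMod 2)), ∀ x, e x = commutatorCoord x :=
  exists_mulEquiv_pi_subgroup commutatorBasis commutator_eq_closure_range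
    (fun s t => commute_of_mem_commutator_hGroup (commutatorBasis_mem s) (commutatorBasis_mem t))
    commutatorBasis_sq commutatorCoord commutatorCoord_basis

theorem exists_W_equiv :
    Nonempty (W n ≃* (Fin n × Fin n → Multiplicative (ZMod 2))) := by
  obtain ⟨e, -⟩ := exists_mulEquiv_pi_subgroup (fun t => commutatorBasis (n := n) (Sum.inl t))
    W_eq_closure_range
    (fun s t => commute_of_mem_commutator_hGroup (commutatorBasis_mem _) (commutatorBasis_mem _))
    (fun t => commutatorBasis_sq _)
    (MonoidHom.pi fun t => (Pi.evalMonoidHom _ (Sum.inl t)).comp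
      (commutatorCoord.comp (Subgroup.inclusion W_le_commutator)))
    (by
      intro t h
      funext u
      change commutatorCoord ⟨commutatorBasis (Sum.inl t), commutatorBasis_mem _⟩ (Sum.inl u) = _
      rw [commutatorCoord_basis]
      simp [Pi.mulSingle_apply])
  exact ⟨e⟩

theorem exists_H3_equiv :
    Nonempty (H3 n ≃* (TripleIndex n → Multiplicative (ZMod 2))) := by
  obtain ⟨e, -⟩ := exists_mulEquiv_pi_subgroup (fun t => commutatorBasis (n := n) (Sum.inr t))
    H3_eq_closure_range
    (fun s t => commute_of_mem_commutator_hGroup (commutatorBasis_mem _) (commutatorBasis_mem _))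
    (fun t => commutatorBasis_sq _)
    (MonoidHom.pi fun t => (Pi.evalMonoidHom _ (Sum.inr t)).comp
      (commutatorCoord.comp (Subgroup.inclusion H3_le_commutator)))
    (by
      intro t h
      funext u
      change commutatorCoord ⟨commutatorBasis (Sum.inr t), commutatorBasis_mem _⟩ (Sum.inr u) = _
      rw [commutatorCoord_basis]
      simp [Pi.mulSingle_apply])
  exact ⟨e⟩

/-- The triple coordinates vanish on `W` and the pair coordinates on `H3`; together they are
injective. -/
theorem W_inf_H3 : W n ⊓ H3 n = ⊥ := by
  have hW : W n ≤ (⨅ t, ((Pi.evalMonoidHom _ (Sum.inr t)).comp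
      (commutatorCoord (n := n))).ker).map (commutator (HGroup n)).subtype := by
    rw [W_eq_closure_range, Subgroup.closure_le]
    rintro _ ⟨t, rfl⟩
    refine ⟨⟨_, commutatorBasis_mem (Sum.inl t)⟩, ?_, rfl⟩
    simp [MonoidHom.mem_ker, commutatorCoord_basis]
  have hH : H3 n ≤ (⨅ t, ((Pi.evalMonoidHom _ (Sum.inl t)).comp
      (commutatorCoord (n := n))).ker).map (commutator (HGroup n)).subtype := by
    rw [H3_eq_closure_range, Subgroup.closure_le]
    rintro _ ⟨t, rfl⟩
    refine ⟨⟨_, commutatorBasis_mem (Sum.inr t)⟩, ?_, rfl⟩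
    simp [MonoidHom.mem_ker, commutatorCoord_basis]
  rw [eq_bot_iff]
  rintro g ⟨h1, h2⟩
  obtain ⟨x, hx, rfl⟩ := hW h1
  obtain ⟨y, hy, hxy⟩ := hH h2
  obtain rfl : y = x := Subtype.ext hxy
  obtain ⟨e, he⟩ := exists_commutatorCoord_equiv (n := n)
  have : e y = 1 := by
    rw [he]
    funext u
    rcases u with u | u
    · exact Subgroup.mem_iInf.1 hy u
    · exact Subgroup.mem_iInf.1 hx u
  rw [(MulEquiv.map_eq_one_iff e).1 this]
  exact one_mem _

/-! ### The abelianization, finiteness and ranks -/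

/-- Coordinates on `𝓗(n)` with respect to the generators. -/
def genCoord : HGroup n →* (Fin n ⊕ Fin n → Multiplicative (ZMod 2)) :=
  PresentedGroup.toGroup (f := fun s => Pi.mulSingle s (Multiplicative.ofAdd 1)) (by
    -- Every relator is a commutator or a square, hence trivial in an abelian group of exponent two.
    have hc : ∀ u v : Fin n ⊕ Fin n → Multiplicative (ZMod 2), comm u v = 1 := fun u v =>
      comm_eq_one_iff.2 (Commute.all u v)
    have h2 : ∀ u : Multiplicative (ZMod 2), u ^ 2 = 1 := by decide
    have hs : ∀ u : Fin n ⊕ Fin n → Multiplicative (ZMod 2), u ^ 2 = 1 := fun u =>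
      funext fun i => h2 _
    intro r hr
    obtain s | ⟨i, i'⟩ | ⟨j, j'⟩ | ⟨i, j⟩ | ⟨j, i, j'⟩ | ⟨i, j, s⟩ | ⟨s, t, u, v⟩ := hr <;>
    first
    | (rw [map_pow]; exact hs _)
    | (rw [map_comm]; exact hc _ _))

theorem genCoord_gen (s : Fin n ⊕ Fin n) :
    genCoord (gen s) = Pi.mulSingle s (Multiplicative.ofAdd 1) :=
  PresentedGroup.toGroup.of _

theorem exists_X_equiv : Nonempty (X n ≃* (Fin n → Multiplicative (ZMod 2))) := by
  obtain ⟨e, -⟩ := exists_mulEquiv_pi_subgroup (gx (n := n)) (K := X n) rfl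
    commute_gx gx_sq
    (MonoidHom.pi fun t => (Pi.evalMonoidHom _ (Sum.inl t)).comp
      (genCoord.comp (X n).subtype))
    (by
      intro t h
      funext u
      change genCoord (gen (Sum.inl t)) (Sum.inl u) = _
      rw [genCoord_gen]
      simp [Pi.mulSingle_apply])
  exact ⟨e⟩

theorem exists_Y_equiv : Nonempty (Y n ≃* (Fin n → Multiplicative (ZMod 2))) := by
  obtain ⟨e, -⟩ := exists_mulEquiv_pi_subgroup (gy (n := n)) (K := Y n) rfl
    commute_gy gy_sq
    (MonoidHom.pi fun t => (Pi.evalMonoidHom _ (Sum.inr t)).comp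
      (genCoord.comp (Y n).subtype))
    (by
      intro t h
      funext u
      change genCoord (gen (Sum.inr t)) (Sum.inr u) = _
      rw [genCoord_gen]
      simp [Pi.mulSingle_apply])
  exact ⟨e⟩

theorem exists_quotient_equiv : Nonempty (HGroup n ⧸ commutator (HGroup n) ≃*
    (Fin n ⊕ Fin n → Multiplicative (ZMod 2))) := by
  have hker : commutator (HGroup n) ≤ (genCoord (n := n)).ker :=
    Abelianization.commutator_subset_ker _
  obtain ⟨e, -⟩ := exists_mulEquiv_pi
    (fun s => ((gen s : HGroup n) : HGroup n ⧸ commutator (HGroup n)))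
    (by
      have := congrArg (Subgroup.map (QuotientGroup.mk' (commutator (HGroup n))))
        (closure_range_gen (n := n))
      rw [MonoidHom.map_closure, Subgroup.map_top_of_surjective _
        (QuotientGroup.mk'_surjective _), ← Set.range_comp] at this
      exact this)
    (fun s t => (comm_mem_iff_commute_mk _ _ _).1 (comm_mem_commutator _ _))
    (fun s => by rw [← QuotientGroup.mk_pow, gen_sq, QuotientGroup.mk_one])
    (QuotientGroup.lift _ genCoord hker)
    (fun s => genCoord_gen s)
  exact ⟨e⟩

theorem finite_hGroup : Finite (HGroup n) := by
  obtain ⟨e⟩ := exists_quotient_equiv (n := n)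
  obtain ⟨f, -⟩ := exists_commutatorCoord_equiv (n := n)
  have h1 := Finite.of_equiv _ e.symm.toEquiv
  have h2 := Finite.of_equiv _ f.symm.toEquiv
  exact Finite.of_equiv _ (Subgroup.groupEquivQuotientProdSubgroup
    (s := commutator (HGroup n))).symm

theorem X_sup_Y : X n ⊔ Y n = ⊤ := by
  rw [X, Y, ← Subgroup.closure_union, ← closure_range_gen]
  congr 1
  ext w
  simp only [Set.mem_union, Set.mem_range, Sum.exists]
  rfl

theorem card_tripleIndex : Fintype.card (TripleIndex n) = n ^ 2 * (n - 1) / 2 := by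
  have h1 : Fintype.card {t : Fin n × Fin n // t.1 < t.2} = n * (n - 1) / 2 := by
    -- Count the pairs by their larger entry `k`, which leaves `k` choices for the smaller one.
    rw [← Finset.sum_range_id, ← Fin.sum_univ_eq_sum_range (fun k => k)]
    rw [Fintype.card_congr ((Equiv.prodComm _ _).subtypeEquiv
      (p := fun t : Fin n × Fin n => t.1 < t.2)
      (q := fun t : Fin n × Fin n => t.2 < t.1) (fun _ => Iff.rfl)),
      Fintype.card_congr (Equiv.subtypeProdEquivSigmaSubtype fun k i : Fin n => i < k),
      Fintype.card_sigma]
    refine Finset.sum_congr rfl fun k _ => ?_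
    rw [Fintype.card_subtype, Finset.filter_gt_eq_Iio, Fin.card_Iio]
  rw [Fintype.card_prod, h1, Fintype.card_fin, mul_comm, sq, mul_assoc,
    Nat.mul_div_assoc _ (Nat.even_mul_pred_self n).two_dvd]

theorem card_commutatorIndex :
    Fintype.card ((Fin n × Fin n) ⊕ TripleIndex n) = n ^ 2 * (n + 1) / 2 := by
  rw [Fintype.card_sum, card_tripleIndex, Fintype.card_prod, Fintype.card_fin, ← sq]
  -- Writing `n = m + 1` removes the truncated subtraction; then n²(n + 1) = n²(n - 1) + 2n².
  rcases n with _ | m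
  · rfl
  · rw [Nat.add_sub_cancel, show (m + 1) ^ 2 * (m + 1 + 1) = (m + 1) ^ 2 * m + (m + 1) ^ 2 * 2 by
      ring, Nat.add_mul_div_right _ _ two_pos, add_comm]

end Structure

/-! ### Extending automorphisms of `X` and `Y` -/

section Automorphisms

variable {n : ℕ}

theorem comm_comm_eq_one_of_mem_Y {g b : HGroup n} (hg : g ∈ commutator (HGroup n))
    (hb : b ∈ Y n) : comm g b = 1 := by
  have h : ⁅commutator (HGroup n), Y n⁆ ≤ ⊥ := by
    rw [commutator_eq_closure_range, Y]
    apply commutator_closure_le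
    rintro _ ⟨t, rfl⟩ _ ⟨j, rfl⟩
    rw [Subgroup.mem_bot]
    rcases t with ⟨i, j'⟩ | ⟨⟨⟨i, k⟩, _⟩, j'⟩
    · exact comm_comm_gy i j' j
    · exact comm_eq_one_iff.2
        (Subgroup.mem_center_iff.1 (H3_le_center (comm_comm_mem_H3 _ _ _)) _).symm
  exact h (comm_mem_of_mem hg hb)

theorem sq_of_mem_X {c : HGroup n} (hc : c ∈ X n) : c ^ 2 = 1 := by
  refine sq_eq_one_of_mem_closure ?_ ?_ hc
  · rintro _ ⟨s, rfl⟩ _ ⟨t, rfl⟩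
    exact commute_gx s t
  · rintro _ ⟨s, rfl⟩
    exact gx_sq s

theorem sq_of_mem_Y {c : HGroup n} (hc : c ∈ Y n) : c ^ 2 = 1 := by
  refine sq_eq_one_of_mem_closure ?_ ?_ hc
  · rintro _ ⟨s, rfl⟩ _ ⟨t, rfl⟩
    exact commute_gy s t
  · rintro _ ⟨s, rfl⟩
    exact gy_sq s

theorem commute_of_mem_X {c d : HGroup n} (hc : c ∈ X n) (hd : d ∈ X n) : Commute c d := by
  refine commute_of_mem_closure ?_ hc hd
  rintro _ ⟨s, rfl⟩ _ ⟨t, rfl⟩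
  exact commute_gx s t

theorem commute_of_mem_Y {c d : HGroup n} (hc : c ∈ Y n) (hd : d ∈ Y n) : Commute c d := by
  refine commute_of_mem_closure ?_ hc hd
  rintro _ ⟨s, rfl⟩ _ ⟨t, rfl⟩
  exact commute_gy s t

theorem comm_comm_comm_eq_one (a b c d : HGroup n) : comm (comm (comm a b) c) d = 1 :=
  comm_eq_one_iff.2 (Subgroup.mem_center_iff.1 (H3_le_center (comm_comm_mem_H3 a b c)) d).symm

theorem gx_mem_X (i : Fin n) : gx i ∈ X n := Subgroup.subset_closure ⟨i, rfl⟩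

theorem gy_mem_Y (j : Fin n) : gy j ∈ Y n := Subgroup.subset_closure ⟨j, rfl⟩

/-- The values on the generators of the endomorphism extending endomorphisms of `X` and `Y`. -/
def extendGen (α : X n →* X n) (β : Y n →* Y n) : Fin n ⊕ Fin n → HGroup n :=
  Sum.elim (fun i => α ⟨gx i, gx_mem_X i⟩) (fun j => β ⟨gy j, gy_mem_Y j⟩)

/-- The relations survive replacing generators by any elements of `X` and `Y`: these subgroups are
abelian with all squares trivial, the derived subgroup has trivial squares and commutes with `Y`,
and `H3` is central. -/
theorem lift_extendGen_relator (α : X n →* X n) (β : Y n →* Y n)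
    (w : FreeGroup (Fin n ⊕ Fin n)) (h : w ∈ {w | Relator n w}) :
    FreeGroup.lift (extendGen α β) w = 1 := by
  have hx : ∀ i : Fin n, FreeGroup.lift (extendGen α β) (fx i) ∈ X n :=
    fun i => by simp [fx, extendGen]
  have hy : ∀ j : Fin n, FreeGroup.lift (extendGen α β) (fy j) ∈ Y n :=
    fun j => by simp [fy, extendGen]
  obtain s | ⟨i, i'⟩ | ⟨j, j'⟩ | ⟨i, j⟩ | ⟨j, i, j'⟩ | ⟨i, j, s⟩ | ⟨s, t, u, v⟩ := h
  · rw [map_pow]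
    cases s
    · exact sq_of_mem_X (hx _)
    · exact sq_of_mem_Y (hy _)
  · rw [map_comm, comm_eq_one_iff.2 (commute_of_mem_X (hx i) (hx i'))]
  · rw [map_comm, comm_eq_one_iff.2 (commute_of_mem_Y (hy j) (hy j'))]
  · rw [map_pow, map_comm, sq_of_mem_commutator (comm_mem_commutator _ _)]
  · rw [map_comm, map_comm, comm_comm_eq_one_of_mem_Y (comm_mem_commutator _ _) (hy j')]
  · rw [map_pow, map_comm, sq_of_mem_commutator (comm_mem_commutator _ _)]
  · simp only [map_comm, comm_comm_comm_eq_one]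

/-- The endomorphism of `𝓗(n)` extending given endomorphisms of `X` and `Y`. -/
def extend (α : X n →* X n) (β : Y n →* Y n) : HGroup n →* HGroup n :=
  PresentedGroup.toGroup (lift_extendGen_relator α β)

theorem extend_gx (α : X n →* X n) (β : Y n →* Y n) (i : Fin n) :
    extend α β (gx i) = α ⟨gx i, gx_mem_X i⟩ :=
  PresentedGroup.toGroup.of _

theorem extend_gy (α : X n →* X n) (β : Y n →* Y n) (j : Fin n) :
    extend α β (gy j) = β ⟨gy j, gy_mem_Y j⟩ :=
  PresentedGroup.toGroup.of _

theorem extend_of_mem_X (α : X n →* X n) (β : Y n →* Y n) (x : X n) :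
    extend α β x = α x := by
  have h : (extend α β).comp (X n).subtype = (X n).subtype.comp α := by
    apply MonoidHom.eq_of_eqOn_dense
      (Subgroup.closure_closure_coe_preimage (k := Set.range (gx (n := n))))
    rintro ⟨_, hx⟩ ⟨i, rfl⟩
    exact extend_gx α β i
  exact DFunLike.congr_fun h x

theorem extend_of_mem_Y (α : X n →* X n) (β : Y n →* Y n) (y : Y n) :
    extend α β y = β y := by
  have h : (extend α β).comp (Y n).subtype = (Y n).subtype.comp β := by
    apply MonoidHom.eq_of_eqOn_dense
      (Subgroup.closure_closure_coe_preimage (k := Set.range (gy (n := n))))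
    rintro ⟨_, hx⟩ ⟨i, rfl⟩
    exact extend_gy α β i
  exact DFunLike.congr_fun h y

theorem hom_ext_hGroup {G : Type*} [Group G] {φ ψ : HGroup n →* G}
    (hx : ∀ i, φ (gx i) = ψ (gx i)) (hy : ∀ j, φ (gy j) = ψ (gy j)) : φ = ψ := by
  apply MonoidHom.eq_of_eqOn_dense closure_range_gen
  rintro _ ⟨i | j, rfl⟩
  · exact hx i
  · exact hy j

theorem extend_comp_extend {α α' : X n →* X n} {β β' : Y n →* Y n}
    (hα : ∀ x, α (α' x) = x) (hβ : ∀ y, β (β' y) = y) :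
    (extend α β).comp (extend α' β') = MonoidHom.id _ := by
  apply hom_ext_hGroup
  · intro i
    rw [MonoidHom.comp_apply, extend_gx, extend_of_mem_X, hα]
    rfl
  · intro j
    rw [MonoidHom.comp_apply, extend_gy, extend_of_mem_Y, hβ]
    rfl

theorem existsUnique_mulAut_extending (α : MulAut (X n)) (β : MulAut (Y n)) :
    ∃! φ : MulAut (HGroup n),
      (∀ x : X n, φ (x : HGroup n) = (α x : HGroup n)) ∧
      (∀ y : Y n, φ (y : HGroup n) = (β y : HGroup n)) := by
  refine ⟨MonoidHom.toMulEquiv (extend α.toMonoidHom β.toMonoidHom)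
    (extend α.symm.toMonoidHom β.symm.toMonoidHom)
    (extend_comp_extend (fun x => α.symm_apply_apply x) (fun y => β.symm_apply_apply y))
    (extend_comp_extend (fun x => α.apply_symm_apply x) (fun y => β.apply_symm_apply y)),
    ⟨fun x => extend_of_mem_X _ _ x, fun y => extend_of_mem_Y _ _ y⟩, ?_⟩
  rintro φ ⟨h1, h2⟩
  apply MulEquiv.toMonoidHom_injective
  apply hom_ext_hGroup
  · intro i
    exact (h1 ⟨gx i, gx_mem_X i⟩).trans (extend_gx α.toMonoidHom β.toMonoidHom i).symm
  · intro j
    exact (h2 ⟨gy j, gy_mem_Y j⟩).trans (extend_gy α.toMonoidHom β.toMonoidHom j).symm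

/-! ### Words and commutators modulo `H3` -/

theorem exists_list_prod {G ι : Type*} [Group G] {g : ι → G} (h2 : ∀ i, g i ^ 2 = 1) {c : G}
    (hc : c ∈ Subgroup.closure (Set.range g)) : ∃ I : List ι, c = (I.map g).prod := by
  induction hc using Subgroup.closure_induction with
  | mem x hx =>
    obtain ⟨i, rfl⟩ := hx
    exact ⟨[i], by simp⟩
  | one => exact ⟨[], rfl⟩
  | mul x y _ _ hx hy =>
    obtain ⟨I, rfl⟩ := hx
    obtain ⟨J, rfl⟩ := hy
    exact ⟨I ++ J, by simp⟩
  | inv x _ hx =>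
    obtain ⟨I, rfl⟩ := hx
    -- Each letter is its own inverse, so the reversed word represents the inverse.
    refine ⟨I.reverse, ?_⟩
    have hi : (fun x => x⁻¹) ∘ g = g := funext fun i =>
      inv_eq_of_mul_eq_one_left (by rw [← sq, h2])
    rw [List.prod_inv_reverse, List.map_map, hi, List.map_reverse]

theorem comm_mk_mem_center (a b : HGroup n ⧸ H3 n) :
    comm a b ∈ Subgroup.center (HGroup n ⧸ H3 n) := by
  obtain ⟨a, rfl⟩ := QuotientGroup.mk_surjective a
  obtain ⟨b, rfl⟩ := QuotientGroup.mk_surjective b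
  rw [Subgroup.mem_center_iff]
  intro c
  obtain ⟨c, rfl⟩ := QuotientGroup.mk_surjective c
  exact ((comm_mem_iff_commute_mk (H3 n) _ _).1 (comm_comm_mem_H3 a b c)).symm

theorem mk_comm_list_prod (I J : List (Fin n)) :
    (QuotientGroup.mk (comm (I.map gx).prod (J.map gy).prod) : HGroup n ⧸ H3 n) =
      QuotientGroup.mk ((I.flatMap fun i => J.map fun j => comm (gx i) (gy j)).prod) := by
  have h := comm_list_prod (comm_mk_mem_center (n := n))
    (fun i => ((gx i : HGroup n) : HGroup n ⧸ H3 n))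
    (fun j => ((gy j : HGroup n) : HGroup n ⧸ H3 n)) I J
  have hm := map_list_prod (QuotientGroup.mk' (H3 n))
  simp only [QuotientGroup.coe_mk'] at hm
  have hc := map_comm (QuotientGroup.mk' (H3 n))
  simp only [QuotientGroup.coe_mk'] at hc
  rw [hc, hm, hm, hm, List.map_map, List.map_map, List.map_flatMap]
  simp only [List.map_map]
  refine Eq.trans h ?_
  rfl

end Automorphisms

end MixedDihedral

theorem mainTheorem3 (n : ℕ) (hn : 2 ≤ n) :
    -- (1)
    (∀ i i' j : Fin n,
      MixedDihedral.comm (MixedDihedral.comm (MixedDihedral.gx i) (MixedDihedral.gy j))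
          (MixedDihedral.gx i') =
        MixedDihedral.comm (MixedDihedral.comm (MixedDihedral.gx i') (MixedDihedral.gy j))
          (MixedDihedral.gx i)) ∧
    -- (2)
    (Nonempty (MixedDihedral.HGroup n ⧸ commutator (MixedDihedral.HGroup n) ≃*
        MixedDihedral.C2pow (2 * n)) ∧
      MixedDihedral.IsMixedDihedral n (MixedDihedral.X n) (MixedDihedral.Y n)) ∧
    -- (3)
    (MixedDihedral.IsInternalDirectProduct (commutator (MixedDihedral.HGroup n))
        (MixedDihedral.W n) (MixedDihedral.H3 n) ∧
      Nonempty (commutator (MixedDihedral.HGroup n) ≃*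
        MixedDihedral.C2pow (n ^ 2 * (n + 1) / 2)) ∧
      Nonempty (MixedDihedral.W n ≃* MixedDihedral.C2pow (n ^ 2)) ∧
      MixedDihedral.H3 n = Subgroup.closure {w | ∃ i j k : Fin n, i < k ∧
        w = MixedDihedral.comm (MixedDihedral.comm (MixedDihedral.gx i) (MixedDihedral.gy j))
          (MixedDihedral.gx k)} ∧
      Nonempty (MixedDihedral.H3 n ≃* MixedDihedral.C2pow (n ^ 2 * (n - 1) / 2)) ∧
      MixedDihedral.H3 n ≤ Subgroup.center (MixedDihedral.HGroup n)) ∧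
    -- (4)
    (∀ a : MixedDihedral.HGroup n, ∀ b ∈ MixedDihedral.Y n, ∀ b' ∈ MixedDihedral.Y n,
      MixedDihedral.comm (MixedDihedral.comm b a) b' = 1 ∧
        MixedDihedral.comm (MixedDihedral.comm a b) b' = 1) ∧
    -- (5)
    (∀ (α : MulAut (MixedDihedral.X n)) (β : MulAut (MixedDihedral.Y n)),
      ∃! φ : MulAut (MixedDihedral.HGroup n),
        (∀ x : MixedDihedral.X n, φ (x : MixedDihedral.HGroup n) = (α x : MixedDihedral.HGroup n)) ∧
        (∀ y : MixedDihedral.Y n,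
          φ (y : MixedDihedral.HGroup n) = (β y : MixedDihedral.HGroup n))) ∧
    -- (6): every element of `X` (of `Y`) is a word in the `x_i` (in the `y_j`), and the
    -- formula for `[c, d]` modulo `𝓗(n)₃` holds for all such words, minimal or not
    (∀ c ∈ MixedDihedral.X n, ∀ d ∈ MixedDihedral.Y n,
      (∃ I : List (Fin n), c = (I.map MixedDihedral.gx).prod) ∧
      (∃ J : List (Fin n), d = (J.map MixedDihedral.gy).prod) ∧
      ∀ I J : List (Fin n),
        c = (I.map MixedDihedral.gx).prod → d = (J.map MixedDihedral.gy).prod →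
        (QuotientGroup.mk (MixedDihedral.comm c d) :
            MixedDihedral.HGroup n ⧸ MixedDihedral.H3 n) =
          QuotientGroup.mk ((I.flatMap fun i => J.map fun j =>
            MixedDihedral.comm (MixedDihedral.gx i) (MixedDihedral.gy j)).prod)) := by
  open MixedDihedral in
  refine ⟨comm_comm_gx_swap, ⟨?_, hn, finite_hGroup, exists_X_equiv, exists_Y_equiv, X_sup_Y, ?_⟩,
    ⟨⟨?_, W_inf_H3, W_sup_H3⟩, ?_, ?_, H3_eq_closure, ?_, H3_le_center⟩, ?_,
    existsUnique_mulAut_extending, ?_⟩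
  · obtain ⟨e⟩ := exists_quotient_equiv (n := n)
    exact nonempty_mulEquiv_C2pow (by simp [two_mul]) e
  · obtain ⟨e⟩ := exists_quotient_equiv (n := n)
    exact nonempty_mulEquiv_C2pow (by simp [two_mul]) e
  · exact fun a ha b hb =>
      commute_of_mem_commutator_hGroup (W_le_commutator ha) (H3_le_commutator hb)
  · obtain ⟨e, -⟩ := exists_commutatorCoord_equiv (n := n)
    exact nonempty_mulEquiv_C2pow card_commutatorIndex e
  · obtain ⟨e⟩ := exists_W_equiv (n := n)
    exact nonempty_mulEquiv_C2pow (by simp [sq]) e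
  · obtain ⟨e⟩ := exists_H3_equiv (n := n)
    exact nonempty_mulEquiv_C2pow card_tripleIndex e
  · exact fun a b _ b' hb' => ⟨comm_comm_eq_one_of_mem_Y (comm_mem_commutator b a) hb',
      comm_comm_eq_one_of_mem_Y (comm_mem_commutator a b) hb'⟩
  · refine fun c hc d hd => ⟨exists_list_prod gx_sq hc, exists_list_prod gy_sq hd, ?_⟩
    rintro I J rfl rfl
    exact mk_comm_list_prod I J
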